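/- Let $1\le m<N$ be integers and let $H\in\mathbb{C}^{N\times N}$ be a Hermitian negative definite matrix with eigenvalues $\lambda_1\le\lambda_2\le\dots\le\lambda_N<0$ (counted with multiplicity), and suppose that $\lambda_m<\lambda_{m+1}$. For $\mu>0$ and $X\in\mathbb{C}^{N\times m}$ put $$E_\mu(X)=\operatorname{tr}\bigl[(2I-X^*X)\,X^*HX\bigr]+\mu\sum_{i=1}^{N}\sum_{j=1}^{m}|X_{ij}|,$$ and let $S_\mu$ be the set of global minimizers of $E_\mu$ over $\mathbb{C}^{N\times m}$. Then for every $\alpha\in(0,1)$ there exists $\mu_0>0$ (depending on $\alpha$, $H$ and $m$) such that for all $0<\mu<\mu_0$ and all $X_\mu\in S_\mu$, $$\|X_\mu^*X_\mu-I\|_F\le\frac{2\mu m\sqrt{N}}{\alpha^2(\lambda_{m+1}-\lambda_m)},$$ where $\|\cdot\|_F$ denotes the Frobenius norm. -/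

import Mathlib

open scoped ComplexOrder Matrix Matrix.Norms.Frobenius

namespace OMM

/-- The orbital minimization functional `E₀(X) = tr[(2I - X*X) X*HX]`. For Hermitian `H` this trace
is a real number (see `trace_eq_E0`), and `E₀` is that real number. -/
noncomputable def E0 {N m : ℕ} (H : Matrix (Fin N) (Fin N) ℂ)
    (X : Matrix (Fin N) (Fin m) ℂ) : ℝ :=
  ((2 - Xᴴ * X) * (Xᴴ * H * X)).trace.re

theorem trace_eq_E0 {N m : ℕ} {H : Matrix (Fin N) (Fin N) ℂ} (hH : H.IsHermitian)
    (X : Matrix (Fin N) (Fin m) ℂ) :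
    ((2 - Xᴴ * X) * (Xᴴ * H * X)).trace = (E0 H X : ℂ) := by
  have h : star ((2 - Xᴴ * X) * (Xᴴ * H * X)).trace
      = ((2 - Xᴴ * X) * (Xᴴ * H * X)).trace := by
    rw [← Matrix.trace_conjTranspose, Matrix.conjTranspose_mul, Matrix.trace_mul_comm]
    simp [Matrix.conjTranspose_mul, hH.eq, Matrix.mul_assoc]
  exact (Complex.conj_eq_iff_re.mp h).symm

/-- The entrywise `ℓ¹` norm `∑ᵢ ∑ⱼ |Xᵢⱼ|`. -/
noncomputable def l1Norm {N m : ℕ} (X : Matrix (Fin N) (Fin m) ℂ) : ℝ :=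
  ∑ i, ∑ j, ‖X i j‖

/-- The penalized functional `E_μ(X) = E₀(X) + μ ‖X‖₁`. -/
noncomputable def E {N m : ℕ} (H : Matrix (Fin N) (Fin N) ℂ) (μ : ℝ)
    (X : Matrix (Fin N) (Fin m) ℂ) : ℝ :=
  E0 H X + μ * l1Norm X

/-- The set `S_μ` of global minimizers of `E_μ` over all complex `N × m` matrices. -/
def S {N : ℕ} (m : ℕ) (H : Matrix (Fin N) (Fin N) ℂ) (μ : ℝ) :
    Set (Matrix (Fin N) (Fin m) ℂ) :=
  {X | ∀ Y : Matrix (Fin N) (Fin m) ℂ, E H μ X ≤ E H μ Y}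

/-- The eigenvalues of a Hermitian matrix, with multiplicity, in nondecreasing order
(`eigenvalues₀` lists them in nonincreasing order). The index is zero-based: `eig hH k` is
`λ_{k+1}` when the eigenvalues are written `λ₁ ≤ λ₂ ≤ … ≤ λ_N`. -/
noncomputable def eig {N : ℕ} {H : Matrix (Fin N) (Fin N) ℂ} (hH : H.IsHermitian)
    (k : Fin N) : ℝ :=
  hH.eigenvalues₀ (Fin.cast (Fintype.card_fin N).symm k.rev)

theorem eig_monotone {N : ℕ} {H : Matrix (Fin N) (Fin N) ℂ} (hH : H.IsHermitian) :
    Monotone (eig hH) := fun _ _ h =>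
  hH.eigenvalues₀_antitone (by simpa [Fin.le_def] using Fin.rev_le_rev.mpr h)

end OMM

namespace OMM

/-! Write `D = I - X*X` and `Z = XD`. The derivative of `E₀` at a minimizer `X` in the direction `Z`
is `4 tr(Z*HZ)`, which is strongly negative unless `Z` is small, while the penalty grows at most at
rate `μ‖Z‖₁ ≤ μ√(Nm)‖Z‖`. Hence `4|tr(Z*HZ)| ≤ μ√(Nm)‖Z‖` (`neg_trace_le_of_mem_S`).

To bound `D` rather than `Z`, `X` must be far from rank deficient. In an eigenbasis, `E₀` separates
over the rows of `I - YY*` (`E0_diagonal`). Comparison with the lowest `m` eigenvectors and the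
spectral gap then make `D` and the leading row defects small for small `μ`
(`gap_mul_sum_rowDefect_le`). In that regime the leading rows of `Z` carry at least `‖D‖²/2`, and
`‖Z‖ ≤ 2‖D‖` (`half_norm_sq_le_sum_leading`). Weighting those rows by `|λ_m|` turns the first-order
condition into `‖D‖ ≤ μ√(Nm)/|λ_m|`, which is stronger than the claim. -/

/-! ### Norms and the ordered spectral decomposition. -/

theorem frobenius_norm_sq {n k : Type*} [Fintype n] [Fintype k] (A : Matrix n k ℂ) :
    ‖A‖ ^ 2 = ∑ i, ∑ j, ‖A i j‖ ^ 2 := by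
  rw [Matrix.frobenius_norm_def, ← Real.sqrt_eq_rpow, Real.sq_sqrt (by positivity)]
  simp

theorem mul_conjTranspose_diag_re {n k : Type*} [Fintype k] (A : Matrix n k ℂ) (i : n) :
    ((A * Aᴴ) i i).re = ∑ j, ‖A i j‖ ^ 2 := by
  simp [Matrix.mul_apply, Matrix.conjTranspose_apply, Complex.mul_conj, Complex.normSq_eq_norm_sq]
  norm_cast

theorem trace_mul_conjTranspose_re {n k : Type*} [Fintype n] [Fintype k] (A : Matrix n k ℂ) :
    (A * Aᴴ).trace.re = ‖A‖ ^ 2 := by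
  rw [frobenius_norm_sq, Matrix.trace, Complex.re_sum]
  exact Finset.sum_congr rfl fun i _ => mul_conjTranspose_diag_re A i

theorem trace_conjTranspose_mul_re {n k : Type*} [Fintype n] [Fintype k] (A : Matrix n k ℂ) :
    (Aᴴ * A).trace.re = ‖A‖ ^ 2 := by
  rw [Matrix.trace_mul_comm, trace_mul_conjTranspose_re]

theorem norm_unitary_mul {N m : ℕ} {W : Matrix (Fin N) (Fin N) ℂ} (hW : Wᴴ * W = 1)
    (Y : Matrix (Fin N) (Fin m) ℂ) : ‖W * Y‖ = ‖Y‖ := by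
  have h : ‖W * Y‖ ^ 2 = ‖Y‖ ^ 2 := by
    rw [← trace_conjTranspose_mul_re, ← trace_conjTranspose_mul_re, Matrix.conjTranspose_mul,
      Matrix.mul_assoc, ← Matrix.mul_assoc Wᴴ, hW, Matrix.one_mul]
  exact (sq_eq_sq₀ (norm_nonneg _) (norm_nonneg _)).1 h

theorem l1Norm_nonneg {N m : ℕ} (X : Matrix (Fin N) (Fin m) ℂ) : 0 ≤ l1Norm X := by
  unfold l1Norm; positivity

theorem l1Norm_add_smul_le {N m : ℕ} (X Z : Matrix (Fin N) (Fin m) ℂ) {t : ℝ} (ht : 0 ≤ t) :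
    l1Norm (X + (t : ℂ) • Z) ≤ l1Norm X + t * l1Norm Z := by
  simp only [l1Norm, Finset.mul_sum, ← Finset.sum_add_distrib]
  gcongr with i _ j _
  simpa [abs_of_nonneg ht] using norm_add_le (X i j) ((t : ℂ) * Z i j)

theorem l1Norm_le {N m : ℕ} (X : Matrix (Fin N) (Fin m) ℂ) :
    l1Norm X ≤ √(N * m) * ‖X‖ := by
  apply le_of_sq_le_sq _ (by positivity)
  rw [mul_pow, Real.sq_sqrt (by positivity), frobenius_norm_sq, l1Norm,
    ← Fintype.sum_prod_type', ← Fintype.sum_prod_type']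
  simpa using sq_sum_le_card_mul_sum_sq (s := Finset.univ)
    (f := fun x : Fin N × Fin m => ‖X x.1 x.2‖)

/-- Spectral decomposition of `H` with the eigenvalues in nondecreasing order. -/
theorem exists_unitary_eig {N : ℕ} {H : Matrix (Fin N) (Fin N) ℂ} (hH : H.IsHermitian) :
    ∃ W : Matrix (Fin N) (Fin N) ℂ, Wᴴ * W = 1 ∧ W * Wᴴ = 1 ∧
      H = W * Matrix.diagonal (fun i => (eig hH i : ℂ)) * Wᴴ := by
  let e := Fintype.equivOfCardEq (Fintype.card_fin (Fintype.card (Fin N)))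
  -- `σ` matches the nondecreasing order of `eig` with the indexing of `eigenvalues`; the columns of
  -- the eigenvector matrix are permuted by it.
  let σ : Fin N ≃ Fin N := (Fin.revPerm.trans (finCongr (Fintype.card_fin N).symm)).trans e
  have hσ (k : Fin N) : eig hH k = hH.eigenvalues (σ k) := by
    simp [eig, Matrix.IsHermitian.eigenvalues, σ, e]
  let U : Matrix (Fin N) (Fin N) ℂ := hH.eigenvectorUnitary
  have hU : Uᴴ * U = 1 := (Matrix.mem_unitaryGroup_iff').1 hH.eigenvectorUnitary.2
  have hU' : U * Uᴴ = 1 := (Matrix.mem_unitaryGroup_iff).1 hH.eigenvectorUnitary.2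
  have hs : H = U * Matrix.diagonal (fun i => (hH.eigenvalues i : ℂ)) * Uᴴ := by
    have := hH.spectral_theorem
    simpa [Unitary.conjStarAlgAut_apply, Function.comp_def, Matrix.star_eq_conjTranspose, U]
      using this
  refine ⟨U.submatrix id σ, ?_, ?_, ?_⟩
  · rw [Matrix.conjTranspose_submatrix, ← Matrix.submatrix_mul _ _ _ _ _ Function.bijective_id, hU]
    simp
  · rw [Matrix.conjTranspose_submatrix, ← Matrix.submatrix_mul _ _ _ _ _ σ.bijective, hU']
    simp
  · have hd : Matrix.diagonal (fun i => (eig hH i : ℂ))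
        = (Matrix.diagonal (fun i => (hH.eigenvalues i : ℂ))).submatrix σ σ := by
      rw [Matrix.submatrix_diagonal_equiv]; simp [hσ, Function.comp_def]
    rw [Matrix.conjTranspose_submatrix, hd, ← Matrix.submatrix_mul _ _ _ _ _ σ.bijective,
      ← Matrix.submatrix_mul _ _ _ _ _ σ.bijective, ← hs]
    simp

theorem eig_neg_of_posDef {N : ℕ} {H : Matrix (Fin N) (Fin N) ℂ} (hH : H.IsHermitian)
    (hneg : (-H).PosDef) (k : Fin N) : eig hH k < 0 := by
  have : hH.eigenvalues (Fintype.equivOfCardEq (Fintype.card_fin (Fintype.card (Fin N)))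
      (Fin.cast (Fintype.card_fin N).symm k.rev)) = eig hH k := by
    simp [eig, Matrix.IsHermitian.eigenvalues]
  rw [← this]
  generalize (Fintype.equivOfCardEq (Fintype.card_fin (Fintype.card (Fin N)))
      (Fin.cast (Fintype.card_fin N).symm k.rev)) = j
  have hv : hH.eigenvectorBasis j ≠ 0 := (hH.eigenvectorBasis.orthonormal.ne_zero j)
  have h := hneg.dotProduct_mulVec_pos (x := (hH.eigenvectorBasis j).ofLp)
    (by simpa using hv)
  rw [Matrix.neg_mulVec, dotProduct_neg, neg_pos, ] at h
  rw [hH.eigenvalues_eq]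
  exact (Complex.lt_def.1 h).1

/-! ### First-order optimality. -/

/-- The second-order expansion of `E₀` along `X (I + t (I - X*X))`. -/
theorem E0_add_smul {N m : ℕ} (H : Matrix (Fin N) (Fin N) ℂ) (X : Matrix (Fin N) (Fin m) ℂ) :
    ∃ c₂ c₃ c₄ : ℝ, ∀ t : ℝ, E0 H (X + (t : ℂ) • (X * (1 - Xᴴ * X)))
      = E0 H X + t * (4 * ((X * (1 - Xᴴ * X))ᴴ * H * (X * (1 - Xᴴ * X))).trace.re)
        + t ^ 2 * c₂ + t ^ 3 * c₃ + t ^ 4 * c₄ := by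
  set D := 1 - Xᴴ * X with hD
  have hG : Xᴴ * X = 1 - D := by rw [hD]; abel
  have hDH : Dᴴ = D := by simp [hD, Matrix.conjTranspose_mul]
  set K := Xᴴ * H * X with hK
  -- For `M` a polynomial in `D`, the energy is linear in `K` with a coefficient that is a
  -- polynomial in `D`.
  have key (M : Matrix (Fin m) (Fin m) ℂ) (hM : Mᴴ = M) :
      E0 H (X * M) = (M * (2 - M * (1 - D) * M) * M * K).trace.re := by
    have h1 : (X * M)ᴴ * (X * M) = M * (1 - D) * M := by
      rw [Matrix.conjTranspose_mul, hM, ← hG]; simp only [Matrix.mul_assoc]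
    have h2 : (X * M)ᴴ * H * (X * M) = M * K * M := by
      rw [Matrix.conjTranspose_mul, hM, hK]; simp only [Matrix.mul_assoc]
    rw [E0, h1, h2, ← Matrix.mul_assoc, Matrix.trace_mul_comm]
    simp only [Matrix.mul_assoc]
  have h0 : E0 H X = ((1 + D) * K).trace.re := by
    have := key 1 (by simp)
    rw [Matrix.mul_one] at this
    rw [this]; congr 3; noncomm_ring
  have h1 : ((X * D)ᴴ * H * (X * D)).trace.re = (D ^ 2 * K).trace.re := by
    rw [Matrix.conjTranspose_mul, hDH, hK, Matrix.trace_mul_comm, Matrix.trace_mul_comm (D ^ 2),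
      Matrix.trace_mul_comm]
    simp only [Matrix.mul_assoc, pow_two]
    rw [Matrix.trace_mul_comm D]
    simp only [Matrix.mul_assoc]
  refine ⟨((-4 * D ^ 2 + 6 * D ^ 3) * K).trace.re, ((-4 * D ^ 3 + 4 * D ^ 4) * K).trace.re,
    ((-D ^ 4 + D ^ 5) * K).trace.re, fun t => ?_⟩
  have hX : X + (t : ℂ) • (X * D) = X * (1 + (t : ℂ) • D) := by
    rw [Matrix.mul_add, Matrix.mul_one, Matrix.mul_smul]
  rw [hX, key _ (by simp [hDH]), h0, h1]
  have hp : (1 + (t : ℂ) • D) * (2 - (1 + (t : ℂ) • D) * (1 - D) * (1 + (t : ℂ) • D))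
      * (1 + (t : ℂ) • D) = (1 + D) + ((t : ℝ) : ℂ) • ((4 : ℂ) • D ^ 2)
      + ((t ^ 2 : ℝ) : ℂ) • (-4 * D ^ 2 + 6 * D ^ 3) + ((t ^ 3 : ℝ) : ℂ) • (-4 * D ^ 3 + 4 * D ^ 4)
      + ((t ^ 4 : ℝ) : ℂ) • (-D ^ 4 + D ^ 5) := by
    push_cast
    -- Only powers of the single matrix `D` occur, so the identity is checked in the commutative
    -- ring `ℂ[X]` and evaluated at `D`.
    have := congrArg (Polynomial.aeval D) (show
      (1 + Polynomial.C (t : ℂ) * Polynomial.X) * (2 - (1 + Polynomial.C (t : ℂ) * Polynomial.X)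
        * (1 - Polynomial.X) * (1 + Polynomial.C (t : ℂ) * Polynomial.X))
      * (1 + Polynomial.C (t : ℂ) * Polynomial.X)
      = (1 + Polynomial.X) + Polynomial.C (t : ℂ) * (Polynomial.C 4 * Polynomial.X ^ 2)
      + Polynomial.C ((t : ℂ) ^ 2) * (-4 * Polynomial.X ^ 2 + 6 * Polynomial.X ^ 3)
      + Polynomial.C ((t : ℂ) ^ 3) * (-4 * Polynomial.X ^ 3 + 4 * Polynomial.X ^ 4)
      + Polynomial.C ((t : ℂ) ^ 4) * (-Polynomial.X ^ 4 + Polynomial.X ^ 5) by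
        simp only [map_pow, map_ofNat]; ring)
    simp only [map_add, map_mul, map_sub, map_one, map_pow, Polynomial.aeval_X,
      Polynomial.aeval_C, map_neg, map_ofNat] at this
    simpa only [Algebra.smul_def, map_pow, map_ofNat] using this
  rw [hp]
  simp only [Matrix.add_mul, Matrix.smul_mul, Matrix.trace_add, Matrix.trace_smul, Complex.add_re,
    smul_eq_mul, Complex.re_ofReal_mul]
  norm_num

/-- First-order optimality of a minimizer of `E_μ` in the direction `X (I - X*X)`. -/
theorem neg_trace_le_of_mem_S {N m : ℕ} {H : Matrix (Fin N) (Fin N) ℂ} {μ : ℝ} (hμ : 0 ≤ μ)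
    {X : Matrix (Fin N) (Fin m) ℂ} (hX : X ∈ S m H μ) :
    -(4 * ((X * (1 - Xᴴ * X))ᴴ * H * (X * (1 - Xᴴ * X))).trace.re)
      ≤ μ * l1Norm (X * (1 - Xᴴ * X)) := by
  obtain ⟨c₂, c₃, c₄, h⟩ := E0_add_smul H X
  set Z := X * (1 - Xᴴ * X)
  set q := 4 * (Zᴴ * H * Z).trace.re
  -- The limit is one-sided: the `ℓ¹` norm need not be differentiable, but the triangle inequality
  -- bounds its growth for `t > 0`.
  have hlim : Filter.Tendsto (fun t : ℝ => q + t * c₂ + t ^ 2 * c₃ + t ^ 3 * c₄ + μ * l1Norm Z)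
      (nhdsWithin 0 (Set.Ioi 0)) (nhds (q + 0 * c₂ + 0 ^ 2 * c₃ + 0 ^ 3 * c₄ + μ * l1Norm Z)) :=
    (Continuous.tendsto (by fun_prop) 0).mono_left nhdsWithin_le_nhds
  have hge := ge_of_tendsto hlim (b := 0) (by
    filter_upwards [self_mem_nhdsWithin] with t ht
    have ht : 0 < t := ht
    have h1 := hX (X + (t : ℂ) • Z)
    have h2 := mul_le_mul_of_nonneg_left (l1Norm_add_smul_le X Z ht.le) hμ
    rw [E, E, h t] at h1
    refine nonneg_of_mul_nonneg_right (a := t) ?_ ht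
    nlinarith)
  linarith

/-! ### Energy in an eigenbasis and row defects. -/

theorem E0_unitary_conj {N m : ℕ} {W : Matrix (Fin N) (Fin N) ℂ} (hW : Wᴴ * W = 1)
    (A : Matrix (Fin N) (Fin N) ℂ) (Y : Matrix (Fin N) (Fin m) ℂ) :
    E0 (W * A * Wᴴ) (W * Y) = E0 A Y := by
  have hW' (B : Matrix (Fin N) (Fin m) ℂ) : Wᴴ * (W * B) = B := by
    rw [← Matrix.mul_assoc, hW, Matrix.one_mul]
  simp only [E0, Matrix.conjTranspose_mul, Matrix.mul_assoc, hW']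

/-- The squared norm of the `i`-th row of `I - YY*`. -/
noncomputable def rowDefect {N m : ℕ} (Y : Matrix (Fin N) (Fin m) ℂ) (i : Fin N) : ℝ :=
  ∑ j, ‖(1 - Y * Yᴴ : Matrix (Fin N) (Fin N) ℂ) i j‖ ^ 2

theorem rowDefect_nonneg {N m : ℕ} (Y : Matrix (Fin N) (Fin m) ℂ) (i : Fin N) :
    0 ≤ rowDefect Y i := by
  unfold rowDefect; positivity

theorem rowDefect_eq {N m : ℕ} (Y : Matrix (Fin N) (Fin m) ℂ) (i : Fin N) :
    rowDefect Y i = (((1 - Y * Yᴴ) * (1 - Y * Yᴴ) : Matrix (Fin N) (Fin N) ℂ) i i).re := by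
  rw [rowDefect, ← mul_conjTranspose_diag_re]
  simp [Matrix.conjTranspose_mul]

/-- By `Y(2 - Y*Y)Y* = I - (I - YY*)²` and cyclicity of the trace, only the diagonal of `(I - YY*)²`
matters. -/
theorem E0_diagonal {N m : ℕ} (l : Fin N → ℝ) (Y : Matrix (Fin N) (Fin m) ℂ) :
    E0 (Matrix.diagonal (fun i => (l i : ℂ))) Y = ∑ i, l i * (1 - rowDefect Y i) := by
  set Λ : Matrix (Fin N) (Fin N) ℂ := Matrix.diagonal (fun i => (l i : ℂ))
  have h : ((2 - Yᴴ * Y) * (Yᴴ * Λ * Y)).trace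
      = ((1 - (1 - Y * Yᴴ) * (1 - Y * Yᴴ)) * Λ).trace := by
    have h1 : (1 - (1 - Y * Yᴴ) * (1 - Y * Yᴴ)) = Y * ((2 - Yᴴ * Y) * Yᴴ) := by
      have : Y * ((2 - Yᴴ * Y) * Yᴴ) = 2 • (Y * Yᴴ) - Y * Yᴴ * (Y * Yᴴ) := by
        rw [Matrix.sub_mul, Matrix.mul_sub, ← one_add_one_eq_two, Matrix.add_mul]
        simp only [Matrix.one_mul, Matrix.mul_assoc, Matrix.mul_add, two_smul]
      rw [this]; noncomm_ring
    rw [h1, Matrix.mul_assoc Y, Matrix.trace_mul_comm Y]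
    simp only [Matrix.mul_assoc]
  rw [E0, h, Matrix.trace, Complex.re_sum]
  refine Finset.sum_congr rfl fun i _ => ?_
  rw [rowDefect_eq]
  simp [Λ, Matrix.mul_diagonal, mul_comm]

/-- `YY*` and `Y*Y` have equal traces and equal traces of squares, so only the sizes of the identity
matrices differ. -/
theorem sum_rowDefect {N m : ℕ} (Y : Matrix (Fin N) (Fin m) ℂ) :
    ∑ i, rowDefect Y i = N - m + ‖1 - Yᴴ * Y‖ ^ 2 := by
  have h1 : ∑ i, rowDefect Y i = ((1 - Y * Yᴴ) * (1 - Y * Yᴴ)).trace.re := by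
    rw [Matrix.trace, Complex.re_sum]
    exact Finset.sum_congr rfl fun i _ => rowDefect_eq Y i
  have h2 : ‖1 - Yᴴ * Y‖ ^ 2 = ((1 - Yᴴ * Y) * (1 - Yᴴ * Y)).trace.re := by
    rw [← trace_mul_conjTranspose_re]; simp [Matrix.conjTranspose_mul]
  have h3 : (Y * Yᴴ * (Y * Yᴴ)).trace = (Yᴴ * Y * (Yᴴ * Y)).trace := by
    rw [Matrix.mul_assoc, Matrix.trace_mul_comm]; simp only [Matrix.mul_assoc]
  rw [h1, h2]
  simp only [Matrix.sub_mul, Matrix.mul_sub, Matrix.one_mul, Matrix.mul_one, Matrix.trace_sub,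
    Matrix.trace_one, Fintype.card_fin, h3, Matrix.trace_mul_comm Y Yᴴ]
  simp
  ring

/-- From `(I - YY*)² = I - YY* - ZY*`, the term `-|Yᵢ|²` absorbs the cross term by completing the
square. A defect thus exceeds `1` only to second order in `Z`. -/
theorem rowDefect_le {N m : ℕ} (Y : Matrix (Fin N) (Fin m) ℂ) (i : Fin N) :
    rowDefect Y i ≤ 1 + (∑ j, ‖(Y * (1 - Yᴴ * Y) : Matrix (Fin N) (Fin m) ℂ) i j‖ ^ 2) / 4 := by
  set Z := Y * (1 - Yᴴ * Y) with hZ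
  have h1 : (1 - Y * Yᴴ) * (1 - Y * Yᴴ) = 1 - Y * Yᴴ - Z * Yᴴ := by
    have : Z * Yᴴ = Y * Yᴴ - Y * Yᴴ * (Y * Yᴴ) := by
      rw [hZ, Matrix.mul_sub, Matrix.sub_mul]; simp only [Matrix.mul_one, Matrix.mul_assoc]
    rw [this]; noncomm_ring
  rw [rowDefect_eq, h1, Matrix.sub_apply, Matrix.sub_apply, Complex.sub_re, Complex.sub_re,
    mul_conjTranspose_diag_re, Matrix.one_apply_eq, Complex.one_re]
  have h2 : -((Z * Yᴴ) i i).re ≤ ∑ j, ‖Z i j‖ * ‖Y i j‖ := by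
    rw [Matrix.mul_apply, Complex.re_sum, ← Finset.sum_neg_distrib]
    gcongr with j _
    refine (neg_le_abs _).trans ((Complex.abs_re_le_norm _).trans ?_)
    simp
  have h3 : ∑ j, ‖Z i j‖ * ‖Y i j‖ ≤ ∑ j, ‖Y i j‖ ^ 2 + (∑ j, ‖Z i j‖ ^ 2) / 4 := by
    rw [Finset.sum_div, ← Finset.sum_add_distrib]
    gcongr with j _
    nlinarith [sq_nonneg (‖Y i j‖ - ‖Z i j‖ / 2)]
  linarith

/-- The diagonal entry of `I - YY*` is at most its row norm; a small defect therefore keeps the row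
of `Y` from being short. -/
theorem one_sub_le_sqrt_rowDefect {N m : ℕ} (Y : Matrix (Fin N) (Fin m) ℂ) (i : Fin N) :
    1 - ∑ j, ‖Y i j‖ ^ 2 ≤ √(rowDefect Y i) := by
  refine Real.le_sqrt_of_sq_le ?_
  have h1 : 1 - ∑ j, ‖Y i j‖ ^ 2 = ((1 - Y * Yᴴ : Matrix (Fin N) (Fin N) ℂ) i i).re := by
    rw [Matrix.sub_apply, Complex.sub_re, mul_conjTranspose_diag_re]; simp
  rw [h1, ← sq_abs]
  refine (pow_le_pow_left₀ (abs_nonneg _) (Complex.abs_re_le_norm _) 2).trans ?_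
  exact Finset.single_le_sum (f := fun j => ‖(1 - Y * Yᴴ : Matrix (Fin N) (Fin N) ℂ) i j‖ ^ 2) (fun j _ => by positivity)
    (Finset.mem_univ i)

theorem trace_diagonal_sandwich {N m : ℕ} (l : Fin N → ℝ) (Z : Matrix (Fin N) (Fin m) ℂ) :
    (Zᴴ * Matrix.diagonal (fun i => (l i : ℂ)) * Z).trace.re
      = ∑ i, l i * ∑ j, ‖Z i j‖ ^ 2 := by
  rw [Matrix.mul_assoc, Matrix.trace_mul_comm, Matrix.mul_assoc, Matrix.trace, Complex.re_sum]
  refine Finset.sum_congr rfl fun i _ => ?_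
  rw [Matrix.diag_apply, Matrix.diagonal_mul, Complex.re_ofReal_mul, mul_conjTranspose_diag_re]

/-! ### Closeness to the leading eigenspace. -/

/-- The matrix whose columns are the first `m` standard basis vectors. -/
def firstColumns (N m : ℕ) : Matrix (Fin N) (Fin m) ℂ :=
  Matrix.of fun i j => if i.val = j.val then 1 else 0

theorem rowDefect_firstColumns {N m : ℕ} (i : Fin N) :
    rowDefect (firstColumns N m) i = if i.val < m then 0 else 1 := by
  have h (k : Fin N) : (firstColumns N m * (firstColumns N m)ᴴ) i k
      = if i = k ∧ i.val < m then 1 else 0 := by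
    simp only [firstColumns, Matrix.mul_apply, Matrix.conjTranspose_apply, Matrix.of_apply]
    by_cases hi : i.val < m
    · rw [Finset.sum_eq_single (⟨i, hi⟩ : Fin m)]
      · simp [hi, Fin.ext_iff, eq_comm]
      · intro j _ hj
        have : i.val ≠ j.val := fun h => hj (Fin.ext h.symm)
        simp [this]
      · simp
    · rw [Finset.sum_eq_zero]
      · simp [hi]
      · intro j _
        have : i.val ≠ j.val := by omega
        simp [this]
  unfold rowDefect
  simp only [Matrix.sub_apply, h, Matrix.one_apply]
  rw [Finset.sum_eq_single i]
  · split_ifs <;> simp_all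
  · intro k _ hk
    simp [Ne.symm hk]
  · simp

/-- The energy of `Y` bounds its distance from the leading coordinate subspace. -/
theorem gap_mul_sum_rowDefect_le {N m : ℕ} (hmN : m ≤ N) (a : Fin N → ℝ) {b c : ℝ} (hb : 0 ≤ b)
    (hc : ∀ i : Fin N, i.val < m → c ≤ a i) (hab : ∀ i : Fin N, m ≤ i.val → a i ≤ b)
    (ha : ∀ i, 0 ≤ a i) (Y : Matrix (Fin N) (Fin m) ℂ) :
    (c - b) * (∑ i : Fin N with i.val < m, rowDefect Y i) + b * ‖1 - Yᴴ * Y‖ ^ 2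
        - b * ‖Y * (1 - Yᴴ * Y)‖ ^ 2 / 4
      ≤ ∑ i, a i * (rowDefect Y i - if i.val < m then 0 else 1) := by
  set Z := Y * (1 - Yᴴ * Y)
  have hcard : ∑ i : Fin N, (if i.val < m then (0 : ℝ) else 1) = N - m := by
    have h1 : ∑ i : Fin N, (if i.val < m then (1 : ℝ) else 0) = m := by
      rw [Finset.sum_boole, Fin.card_filter_val_lt]; simp [hmN]
    have h2 : ∑ i : Fin N, (if i.val < m then (0 : ℝ) else 1)
        = ∑ i : Fin N, (1 - if i.val < m then (1 : ℝ) else 0) :=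
      Finset.sum_congr rfl fun i _ => by split_ifs <;> simp
    rw [h2, Finset.sum_sub_distrib, h1]; simp
  have hsum : (c - b) * (∑ i : Fin N with i.val < m, rowDefect Y i) + b * ‖1 - Yᴴ * Y‖ ^ 2
      - b * ‖Z‖ ^ 2 / 4 = ∑ i : Fin N, ((c - b) * (if i.val < m then rowDefect Y i else 0)
        + b * (rowDefect Y i - if i.val < m then 0 else 1)
        - b * (∑ j, ‖Z i j‖ ^ 2) / 4) := by
    rw [Finset.sum_sub_distrib, Finset.sum_add_distrib, ← Finset.mul_sum, ← Finset.mul_sum,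
      Finset.sum_sub_distrib, sum_rowDefect, hcard, ← Finset.sum_filter, ← Finset.sum_div,
      ← Finset.mul_sum, frobenius_norm_sq Z]
    ring
  rw [hsum]
  gcongr with i _
  have h1 := rowDefect_le Y i
  have h0 := rowDefect_nonneg Y i
  have hz : 0 ≤ ∑ j, ‖Z i j‖ ^ 2 := by positivity
  split_ifs with hi
  · nlinarith [mul_nonneg hb hz, mul_le_mul_of_nonneg_right (hc i hi) h0]
  -- Replacing `a i` by the larger `b` could fail only where the defect exceeds `1`; `rowDefect_le`
  -- limits the loss to the `b‖Zᵢ‖²/4` already subtracted.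
  · have h2 := mul_nonneg (sub_nonneg.2 (hab i (by omega))) (sub_nonneg.2 h1)
    have h3 := mul_nonneg (ha i) hz
    nlinarith

/-- If `Y*Y` is close to `I` and the leading row defects are small, then the leading rows of
`Y (I - Y*Y)` carry half of the norm of `I - Y*Y`. -/
theorem half_norm_sq_le_sum_leading {N m : ℕ} (hm : 0 < m) (hmN : m ≤ N)
    (Y : Matrix (Fin N) (Fin m) ℂ)
    (hD : ‖1 - Yᴴ * Y‖ ≤ 1 / (8 * m))
    (hd : ∀ i : Fin N, i.val < m → √(rowDefect Y i) ≤ 1 / (8 * m)) :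
    ‖1 - Yᴴ * Y‖ ^ 2 / 2
      ≤ ∑ i : Fin N with i.val < m, ∑ j, ‖(Y * (1 - Yᴴ * Y) : Matrix (Fin N) (Fin m) ℂ) i j‖ ^ 2 ∧
    ‖Y * (1 - Yᴴ * Y)‖ ≤ 2 * ‖1 - Yᴴ * Y‖ := by
  set D := 1 - Yᴴ * Y with hDdef
  have hDH : Dᴴ = D := by simp [hDdef, Matrix.conjTranspose_mul]
  have hm1 : (1 : ℝ) ≤ m := by exact_mod_cast hm
  have hr : 1 / (8 * (m : ℝ)) ≤ 1 / 8 := by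
    apply one_div_le_one_div_of_le <;> linarith
  have hrm : (m : ℝ) * (1 / (8 * m)) = 1 / 8 := by field_simp
  have hentry (i j) : ‖D i j‖ ≤ ‖D‖ := by
    refine le_of_sq_le_sq ?_ (norm_nonneg _)
    rw [frobenius_norm_sq D]
    exact (Finset.single_le_sum (f := fun j => ‖D i j‖ ^ 2) (fun j _ => by positivity)
      (Finset.mem_univ j)).trans (Finset.single_le_sum (f := fun i => ∑ j, ‖D i j‖ ^ 2)
      (fun i _ => by positivity) (Finset.mem_univ i))
  have htr : ‖Y‖ ^ 2 ≤ m + m * ‖D‖ := by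
    have h1 : ‖Y‖ ^ 2 = m - D.trace.re := by
      rw [← trace_conjTranspose_mul_re, show Yᴴ * Y = 1 - D by rw [hDdef]; abel]
      simp
    have h2 : -D.trace.re ≤ ∑ _i : Fin m, ‖D‖ := by
      rw [Matrix.trace, Complex.re_sum, ← Finset.sum_neg_distrib]
      gcongr with i _
      exact (neg_le_abs _).trans ((Complex.abs_re_le_norm _).trans (hentry i i))
    simp at h2
    linarith
  let V : Matrix (Fin N) (Fin m) ℂ := Matrix.of fun i j => if i.val < m then 0 else Y i j
  -- Total mass is at most `m + 1/8` and the leading rows hold at least `m - 1/8`.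
  have hV : ‖V‖ ^ 2 ≤ 1 / 4 := by
    have h1 : ‖V‖ ^ 2 + ∑ i : Fin N with i.val < m, ∑ j, ‖Y i j‖ ^ 2 = ‖Y‖ ^ 2 := by
      rw [frobenius_norm_sq, frobenius_norm_sq, Finset.sum_filter, ← Finset.sum_add_distrib]
      refine Finset.sum_congr rfl fun i _ => ?_
      by_cases hi : i.val < m <;> simp [V, hi]
    have h2 : ∑ i : Fin N with i.val < m, (1 - 1 / (8 * (m : ℝ)))
        ≤ ∑ i : Fin N with i.val < m, ∑ j, ‖Y i j‖ ^ 2 := by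
      refine Finset.sum_le_sum fun i hi => ?_
      have := hd i (by simpa using hi)
      linarith [one_sub_le_sqrt_rowDefect Y i]
    rw [Finset.sum_const, Fin.card_filter_val_lt, min_eq_right hmN, nsmul_eq_mul] at h2
    have h3 : (m : ℝ) * ‖D‖ ≤ 1 / 8 := by rw [← hrm]; gcongr
    linarith
  have hVD : ‖V * D‖ ^ 2 ≤ ‖D‖ ^ 2 / 4 := by
    have h := pow_le_pow_left₀ (norm_nonneg _) (Matrix.frobenius_norm_mul V D) 2
    rw [mul_pow] at h
    nlinarith [sq_nonneg ‖D‖]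
  have hcube : |(D * D * Dᴴ).trace.re| ≤ ‖D‖ ^ 3 := by
    have h1 : (D * D * Dᴴ).trace = ∑ i, ∑ j, (D * D) i j * star (D i j) := by
      simp [Matrix.trace, Matrix.mul_apply (N := Dᴴ)]
    rw [h1]
    refine (Complex.abs_re_le_norm _).trans ?_
    refine (norm_sum_le _ _).trans ((Finset.sum_le_sum fun i _ => norm_sum_le _ _).trans ?_)
    simp only [norm_mul, norm_star]
    rw [← Fintype.sum_prod_type']
    have h2 := Finset.sum_mul_sq_le_sq_mul_sq (Finset.univ : Finset (Fin m × Fin m))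
      (fun x => ‖(D * D) x.1 x.2‖) (fun x => ‖D x.1 x.2‖)
    rw [Fintype.sum_prod_type' (f := fun i j => ‖(D * D) i j‖ ^ 2),
      Fintype.sum_prod_type' (f := fun i j => ‖D i j‖ ^ 2), ← frobenius_norm_sq,
      ← frobenius_norm_sq, ← mul_pow] at h2
    have h3 := le_of_sq_le_sq h2 (by positivity)
    have h4 := mul_le_mul_of_nonneg_right (Matrix.frobenius_norm_mul D D) (norm_nonneg D)
    calc _ ≤ _ := h3
      _ ≤ _ := h4
      _ = _ := by ring
  have hYD : ‖Y * D‖ ^ 2 = ‖D‖ ^ 2 - (D * D * Dᴴ).trace.re := by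
    have h1 : (Y * D)ᴴ * (Y * D) = D * Dᴴ - D * D * Dᴴ := by
      rw [Matrix.conjTranspose_mul, hDH, Matrix.mul_assoc, ← Matrix.mul_assoc Yᴴ,
        show Yᴴ * Y = 1 - D by rw [hDdef]; abel]
      noncomm_ring
    rw [← trace_conjTranspose_mul_re, h1, Matrix.trace_sub, Complex.sub_re,
      trace_mul_conjTranspose_re]
  have hcube' : ‖D‖ ^ 3 ≤ ‖D‖ ^ 2 / 8 := by
    nlinarith [sq_nonneg ‖D‖, hD.trans hr]
  have hsplit : ‖V * D‖ ^ 2 + ∑ i : Fin N with i.val < m, ∑ j, ‖(Y * D) i j‖ ^ 2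
      = ‖Y * D‖ ^ 2 := by
    rw [frobenius_norm_sq, frobenius_norm_sq, Finset.sum_filter, ← Finset.sum_add_distrib]
    refine Finset.sum_congr rfl fun i _ => ?_
    by_cases hi : i.val < m <;> simp [V, hi, Matrix.mul_apply]
  have hc := abs_le.1 hcube
  -- `‖YD‖²` lies between `7/8` and `9/8` of `‖D‖²`, and the trailing rows take at most `1/4`,
  -- leaving `5/8 ≥ 1/2`.
  constructor
  · nlinarith [sq_nonneg ‖D‖]
  · refine le_of_sq_le_sq ?_ (by positivity)
    nlinarith [sq_nonneg ‖D‖]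

/-! ### The estimate for minimizers. -/

/-- The bound for minimizers, in a basis of eigenvectors, under explicit smallness of `μ`. -/
theorem norm_one_sub_le_of_mem_S {N m : ℕ} (hm : 0 < m) (hmN : m ≤ N)
    {W : Matrix (Fin N) (Fin N) ℂ} (hW : Wᴴ * W = 1) (a : Fin N → ℝ) {a₀ b c μ : ℝ}
    (ha₀ : 0 < a₀) (ha : ∀ i, a₀ ≤ a i) (hb : 0 < b) (hbc : b < c)
    (hc : ∀ i : Fin N, i.val < m → c ≤ a i) (hab : ∀ i : Fin N, m ≤ i.val → a i ≤ b)
    (hμ : 0 < μ)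
    (hsmall : μ * l1Norm (W * firstColumns N m) + b * (μ * √(N * m) / (4 * a₀)) ^ 2 / 4
      ≤ min (c - b) b * (1 / (8 * (m : ℝ))) ^ 2)
    {Y : Matrix (Fin N) (Fin m) ℂ}
    (hY : W * Y ∈ S m (W * Matrix.diagonal (fun i => ((-a i : ℝ) : ℂ)) * Wᴴ) μ) :
    ‖1 - Yᴴ * Y‖ ≤ μ * √(N * m) / c := by
  set D := 1 - Yᴴ * Y with hD
  set Z := Y * D with hZ
  set s := √((N : ℝ) * m)
  have hG : (W * Y)ᴴ * (W * Y) = Yᴴ * Y := by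
    rw [Matrix.conjTranspose_mul, Matrix.mul_assoc, ← Matrix.mul_assoc Wᴴ, hW, Matrix.one_mul]
  have ha' (i) : 0 ≤ a i := ha₀.le.trans (ha i)
  have hfirst : 4 * ∑ i, a i * ∑ j, ‖Z i j‖ ^ 2 ≤ μ * (s * ‖Z‖) := by
    have h := neg_trace_le_of_mem_S hμ.le hY
    rw [hG, ← hD, Matrix.mul_assoc W Y D, ← hZ] at h
    have h1 : (W * Z)ᴴ * (W * Matrix.diagonal (fun i => ((-a i : ℝ) : ℂ)) * Wᴴ) * (W * Z)
        = Zᴴ * Matrix.diagonal (fun i => ((-a i : ℝ) : ℂ)) * Z := by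
      have hW' (B : Matrix (Fin N) (Fin m) ℂ) : Wᴴ * (W * B) = B := by
        rw [← Matrix.mul_assoc, hW, Matrix.one_mul]
      simp only [Matrix.conjTranspose_mul, Matrix.mul_assoc, hW']
    rw [h1, trace_diagonal_sandwich (fun i => -a i)] at h
    simp only [neg_mul, Finset.sum_neg_distrib, mul_neg, neg_neg] at h
    have h2 := l1Norm_le (W * Z)
    rw [norm_unitary_mul hW] at h2
    exact h.trans (by gcongr)
  -- This crude bound serves only to control the error `b‖Z‖²/4` in the gap inequality.
  have hZle : ‖Z‖ ≤ μ * s / (4 * a₀) := by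
    have h1 : a₀ * ‖Z‖ ^ 2 ≤ ∑ i, a i * ∑ j, ‖Z i j‖ ^ 2 := by
      rw [frobenius_norm_sq, Finset.mul_sum]
      gcongr with i _
      exact ha i
    rcases (norm_nonneg Z).eq_or_lt with h0 | h0
    · rw [← h0]; positivity
    · rw [le_div_iff₀ (by positivity)]
      refine le_of_mul_le_mul_right ?_ h0
      nlinarith
  have henergy : ∑ i, a i * (rowDefect Y i - if i.val < m then 0 else 1)
      ≤ μ * l1Norm (W * firstColumns N m) := by
    have h := hY (W * firstColumns N m)
    rw [E, E, E0_unitary_conj hW, E0_unitary_conj hW, E0_diagonal (fun i => -a i),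
      E0_diagonal (fun i => -a i)] at h
    simp only [rowDefect_firstColumns] at h
    have h1 : ∑ i, a i * (rowDefect Y i - if i.val < m then 0 else 1)
        = ∑ i, -a i * (1 - rowDefect Y i)
          - ∑ i : Fin N, -a i * (1 - if i.val < m then 0 else 1) := by
      rw [← Finset.sum_sub_distrib]
      exact Finset.sum_congr rfl fun i _ => by ring
    have h2 := mul_nonneg hμ.le (l1Norm_nonneg (W * Y))
    linarith
  have hgap := gap_mul_sum_rowDefect_le hmN a hb.le hc hab ha' Y
  rw [← hD, ← hZ] at hgap
  have hZ2 : b * ‖Z‖ ^ 2 / 4 ≤ b * (μ * s / (4 * a₀)) ^ 2 / 4 := by gcongr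
  set r := 1 / (8 * (m : ℝ))
  have hr : 0 < r := by positivity
  have hsum0 : 0 ≤ ∑ i : Fin N with i.val < m, rowDefect Y i :=
    Finset.sum_nonneg fun i _ => rowDefect_nonneg Y i
  have htotal : (c - b) * (∑ i : Fin N with i.val < m, rowDefect Y i) + b * ‖D‖ ^ 2
      ≤ min (c - b) b * r ^ 2 := by linarith
  have hDle : ‖D‖ ≤ r := by
    refine le_of_sq_le_sq (le_of_mul_le_mul_left ?_ hb) hr.le
    have := mul_le_mul_of_nonneg_right (min_le_right (c - b) b) (sq_nonneg r)
    have := mul_nonneg (sub_pos.2 hbc).le hsum0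
    linarith
  have hdle (i : Fin N) (hi : i.val < m) : √(rowDefect Y i) ≤ r := by
    refine Real.sqrt_le_iff.2 ⟨hr.le, ?_⟩
    refine (Finset.single_le_sum (f := rowDefect Y) (fun i _ => rowDefect_nonneg Y i)
      (show i ∈ Finset.univ.filter (fun i : Fin N => i.val < m) by simpa using hi)).trans
      (le_of_mul_le_mul_left ?_ (sub_pos.2 hbc))
    have := mul_le_mul_of_nonneg_right (min_le_left (c - b) b) (sq_nonneg r)
    have := mul_nonneg hb.le (sq_nonneg ‖D‖)
    linarith
  obtain ⟨hhalf, htwo⟩ := half_norm_sq_le_sum_leading hm hmN Y hDle hdle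
  rw [← hD, ← hZ] at hhalf htwo
  have hc0 : 0 < c := hb.trans hbc
  -- Keeping only the leading rows gives the constant `c` in place of `a₀`.
  have hlead : c * ∑ i : Fin N with i.val < m, ∑ j, ‖Z i j‖ ^ 2
      ≤ ∑ i, a i * ∑ j, ‖Z i j‖ ^ 2 := by
    rw [Finset.mul_sum]
    refine (Finset.sum_le_sum fun i hi => ?_).trans (Finset.sum_le_sum_of_subset_of_nonneg
      (Finset.filter_subset _ _) fun i _ _ => mul_nonneg (ha' i) (by positivity))
    exact mul_le_mul_of_nonneg_right (hc i (by simpa using hi)) (by positivity)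
  rcases (norm_nonneg D).eq_or_lt with h0 | h0
  · rw [← h0]; positivity
  · rw [le_div_iff₀ hc0]
    refine le_of_mul_le_mul_right ?_ h0
    have h1 := mul_le_mul_of_nonneg_left hhalf hc0.le
    have h2 : μ * (s * ‖Z‖) ≤ μ * (s * (2 * ‖D‖)) := by gcongr
    nlinarith

end OMM

theorem corollary2p10 {N m : ℕ} (hm : 0 < m) (hmN : m < N)
    (H : Matrix (Fin N) (Fin N) ℂ) (hH : H.IsHermitian) (hneg : (-H).PosDef)
    (hgap : OMM.eig hH ⟨m - 1, by omega⟩ < OMM.eig hH ⟨m, hmN⟩)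
    (α : ℝ) (hα0 : 0 < α) (hα1 : α < 1) :
    ∃ μ₀ : ℝ, 0 < μ₀ ∧ ∀ μ : ℝ, 0 < μ → μ < μ₀ →
      ∀ X ∈ OMM.S m H μ,
        ‖Xᴴ * X - 1‖ ≤ 2 * μ * m * √(N : ℝ) /
          (α ^ 2 * (OMM.eig hH ⟨m, hmN⟩ - OMM.eig hH ⟨m - 1, by omega⟩)) := by
  obtain ⟨W, hW, hW', hHW⟩ := OMM.exists_unitary_eig hH
  have hmono := OMM.eig_monotone hH
  have hlt := OMM.eig_neg_of_posDef hH hneg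
  have hr : (0 : ℝ) < 1 / (8 * m) := by positivity
  set a : Fin N → ℝ := fun i => -OMM.eig hH i with ha
  -- With zero-based indices, `c = |λ_m|`, `b = |λ_{m+1}|` and `a₀ = |λ_N|`, the smallest of the `a
  -- i`.
  set c := a ⟨m - 1, by omega⟩ with hc
  set b := a ⟨m, hmN⟩ with hb
  set a₀ := a ⟨N - 1, by omega⟩ with ha₀
  have hbpos : 0 < b := neg_pos.2 (hlt _)
  have ha₀pos : 0 < a₀ := neg_pos.2 (hlt _)
  have hbc : b < c := neg_lt_neg hgap
  have hanti {i j : Fin N} (h : i.val ≤ j.val) : a j ≤ a i := neg_le_neg (hmono h)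
  have hHa : H = W * Matrix.diagonal (fun i => ((-a i : ℝ) : ℂ)) * Wᴴ := by
    simpa [ha] using hHW
  -- The left side is continuous in `μ` and vanishes at `0`, which supplies `μ₀`, here independent
  -- of `α`.
  have hlim : ∀ᶠ μ in nhds (0 : ℝ),
      μ * OMM.l1Norm (W * OMM.firstColumns N m) + b * (μ * √(N * m) / (4 * a₀)) ^ 2 / 4
        < min (c - b) b * (1 / (8 * (m : ℝ))) ^ 2 := by
    refine ContinuousAt.eventually_lt (by fun_prop) (by fun_prop) ?_
    have := lt_min (sub_pos.2 hbc) hbpos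
    simp only [zero_mul, zero_div, ne_eq, OfNat.ofNat_ne_zero, not_false_eq_true, zero_pow,
      mul_zero, add_zero]
    positivity
  obtain ⟨μ₀, hμ₀, hball⟩ := Metric.eventually_nhds_iff.1 hlim
  refine ⟨μ₀, hμ₀, fun μ hμ hμlt X hX => ?_⟩
  have hsmall := (hball (y := μ) (by simpa [abs_of_pos hμ] using hμlt)).le
  have hXW : X = W * (Wᴴ * X) := by rw [← Matrix.mul_assoc, hW', Matrix.one_mul]
  have hG : (Wᴴ * X)ᴴ * (Wᴴ * X) = Xᴴ * X := by
    rw [Matrix.conjTranspose_mul, Matrix.conjTranspose_conjTranspose, Matrix.mul_assoc, ← hXW]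
  have hX' : W * (Wᴴ * X) ∈ OMM.S m (W * Matrix.diagonal (fun i => ((-a i : ℝ) : ℂ)) * Wᴴ) μ := by
    rwa [← hHa, ← hXW]
  have hmain := OMM.norm_one_sub_le_of_mem_S hm hmN.le hW a ha₀pos
    (fun i => hanti (show i.val ≤ N - 1 by omega)) hbpos hbc
    (fun i hi => hanti (show i.val ≤ m - 1 by omega)) (fun i hi => hanti hi) hμ hsmall hX'
  rw [hG, norm_sub_rev] at hmain
  refine hmain.trans ?_
  have hsqrt : √((N : ℝ) * m) ≤ m * √N := by
    rw [Real.sqrt_mul (by positivity), mul_comm]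
    gcongr
    exact (Real.sqrt_le_self_iff.2 (Or.inr (by exact_mod_cast hm)))
  -- Since `b > 0` and `α² ≤ 1`, the denominator `α²(c - b)` is at most `c`; the factor `2` in the
  -- numerator is slack.
  have hden : α ^ 2 * (OMM.eig hH ⟨m, hmN⟩ - OMM.eig hH ⟨m - 1, by omega⟩) ≤ c := by
    have h1 : OMM.eig hH ⟨m, hmN⟩ - OMM.eig hH ⟨m - 1, by omega⟩ = c - b := by
      simp only [hc, hb, ha]; ring
    rw [h1]
    have h2 : α ^ 2 ≤ 1 := pow_le_one₀ hα0.le hα1.le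
    nlinarith
  refine div_le_div₀ (by positivity) ?_ (mul_pos (by positivity) (sub_pos.2 hgap)) hden
  have h1 : μ * √((N : ℝ) * m) ≤ μ * (m * √N) := by gcongr
  have h2 : 0 ≤ μ * (m * √(N : ℝ)) := by positivity
  linarith
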